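/- Let $V$ be a countable set of vertices and $\mathcal B$ a family of finite subsets of $V$ (hyperbonds) such that every vertex lies in finitely many of them. Let $F$ be a finite subset of an abelian group, $\Omega=F^V$, and for $b\in\mathcal B$ let $\phi(\omega_b)\in[-\infty,\infty)$, $\omega_b\in F^b$, be an interaction (the value $-\infty$ is a hard constraint, $e^{-\infty}=0$). For finite $\Lambda\subset V$ and $\tilde\omega\in\Omega$ let $\mu_{\Lambda,\tilde\omega}$ be the finite-volume Gibbs measure $$\mu_{\Lambda,\tilde\omega}(\omega_\Lambda)=\frac1Z\exp\Big(\sum_{b\in\mathcal B:\,b\cap\Lambda\ne\emptyset}\phi\big((\omega_\Lambda\tilde\omega_{\Lambda^c})_b\big)\Big),$$ defined when $Z\neq0$ and regarded as a measure on $\Omega$ under which the configuration is $\tilde\omega$ off $\Lambda$. Let $\delta\Lambda$ be the union of the hyperbonds that meet both $\Lambda$ and $\Lambda^c$. A Gibbs state is a probability measure $\mu$ on $\Omega$ such that, for every finite $\Lambda$, $Z\ne0$ for $\mu$-almost every boundary condition $\omega$ and $\mu=\int\mu_{\Lambda,\omega}\,d\mu(\omega)$; it is extremal if it is an extreme point of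 the set of Gibbs states. For $\sigma\in(F+F)^\Lambda$ let $\rho_{\Lambda,\tilde\omega}(\sigma)$ be the probability that two independent configurations with law $\mu_{\Lambda,\tilde\omega}$ have sum $\sigma$ on $\Lambda$, and, if this is positive, let $\mu^\sigma_{\Lambda,\tilde\omega}(\omega)$ be the conditional probability that the two configurations are $\omega$ and $\sigma-\omega$, given that their sum is $\sigma$. Let $F(s)=\{a\in F: s-a\in F\}$, $\Omega(\sigma)=\prod_{i\in\Lambda}F(\sigma_i)$, and, for a hyperbond $b$ meeting $\Lambda$, let $\Omega_b(\sigma)$ be the set of configurations on $b$ with values in $F(\sigma_i)$ at the sites $i\in b\cap\Lambda$ and equal to $\tilde\omega$ on $b\setminus\Lambda$. A $\sigma$-symmetric random cluster representation of $\mu^\sigma_{\Lambda,\tilde\omega}$ is a probability $\nu^\sigma$ on the hyperbond configurations $\eta=(\eta_b)$, $\eta_b\subseteq\Omega_b(\sigma)$, $b$ ranging over the hyperbonds meeting $\Lambda$, such that $$\mu^\sigma_{\Lambda,\tilde\omega}(\omega)=\frac1{Z_1}\sum_\eta\nu^\sigma(\eta)\prod_b\mathbb 1[(\omega\tilde\omega_{\Lambda^c})_b\in\eta_b]\qquad(\omega\in\Omega(\sigma)),$$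 where $Z_1$ is the normalizing factor, and such that, for each $\eta$ with $\nu^\sigma(\eta)>0$, each $\eta_b$ is invariant under the reflection $\omega_i\mapsto\sigma_i-\omega_i$, $i\in b\cap\Lambda$ (the values $\tilde\omega_i$, $i\in b\setminus\Lambda$, being kept). Let $$P^\sigma_{\Lambda,\tilde\omega}(\eta)=\frac1{Z_1}\nu^\sigma(\eta)\,\#\{\omega\in\Omega(\sigma):(\omega\tilde\omega_{\Lambda^c})_b\in\eta_b\text{ for all }b\}.$$ A hyperbond $b$ is active in $\eta$ if $\eta_b\ne\Omega_b(\sigma)$, and $A\leftrightarrow_{act}B$ is the event that there is a chain of active hyperbonds, each intersecting the next, the first of which meets $A$ and the last of which meets $B$. Let $\overline P_{\Lambda,\tilde\omega}$ be the average, over $\sigma$ with law $\rho_{\Lambda,\tilde\omega}$, of the law of the set of active hyperbonds under $P^\sigma_{\Lambda,\tilde\omega}$. Statement. Let $(\Lambda_n)$ be a sequence of finite subsets of $V$ that eventually contains every finite set, and $(\tilde\omega_n)$ a sequence of boundary conditions, such that the measures $\mu_{\Lambda_n,\tilde\omega_n}$ are defined and converge weakly to a probability measure $\mu$ on $\Omega$.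 For every $n$ and every $\sigma$ with $\rho_{\Lambda_n,\tilde\omega_n}(\sigma)>0$ fix a $\sigma$-symmetric random cluster representation of $\mu^\sigma_{\Lambda_n,\tilde\omega_n}$. Suppose that for every finite $\Lambda_0\subset V$ and every $\epsilon>0$ there are finite sets $\Lambda_1\supseteq\Lambda_0$ and $\Lambda_2$ such that for every $n$ with $\Lambda_n\supseteq\Lambda_2$ at least one of the following holds: (a) $\overline P_{\Lambda_n,\tilde\omega_n}(\Lambda_0\leftrightarrow_{act}\delta\Lambda_1)\le\epsilon$; (b) $\rho_{\Lambda_n,\tilde\omega_n}\big(\{\sigma: P^\sigma_{\Lambda_n,\tilde\omega_n}(\Lambda_0\leftrightarrow_{act}\delta\Lambda_1)\le\epsilon\}\big)\ge1-\epsilon$. Then $\mu$ is an extremal Gibbs state. -/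

import Mathlib

open MeasureTheory Filter Topology
open scoped ENNReal NNReal

/-- A lattice spin model on the vertex set `V` with alphabet `F`: a locally finite family of finite
hyperbonds and an interaction `φ`, which gives to every local configuration `ω_b ∈ F^b` an
energy in `[-∞, ∞)`.  Energies enter the Gibbs weight as `exp (∑ φ)`, so that the value
`-∞` is a hard constraint (weight `0`). -/
structure SpinModel (V F : Type*) where
  bonds : Set (Finset V)
  locallyFinite : ∀ v : V, {b ∈ bonds | v ∈ b}.Finite
  φ : (b : Finset V) → (b → F) → EReal
  φ_ne_top : ∀ b ξ, φ b ξ ≠ ⊤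

namespace SpinModel

noncomputable section

variable {V F G : Type*} (M : SpinModel V F)

theorem finite_meeting (Λ : Finset V) : {b ∈ M.bonds | ∃ v ∈ Λ, v ∈ b}.Finite := by
  refine (Λ.finite_toSet.biUnion fun v _ => M.locallyFinite v).subset ?_
  rintro b ⟨hb, v, hv, hvb⟩
  exact Set.mem_biUnion hv ⟨hb, hvb⟩

/-- The hyperbonds that meet `Λ`: those inside `Λ` and those that cross its boundary. -/
def meeting (Λ : Finset V) : Finset (Finset V) := (M.finite_meeting Λ).toFinset

/-- `δΛ`: the vertices of the hyperbonds that meet both `Λ` and its complement. -/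
def boundary (Λ : Finset V) : Set V :=
  {v | ∃ b ∈ M.bonds, v ∈ b ∧ (∃ x ∈ b, x ∈ Λ) ∧ ∃ x ∈ b, x ∉ Λ}

open Classical in
/-- The configuration `ξ_Λ ω_{Λᶜ}`. -/
def glue (Λ : Finset V) (ξ : Λ → F) (ω : V → F) : V → F :=
  fun i => if h : i ∈ Λ then ξ ⟨i, h⟩ else ω i

/-- The unnormalised Gibbs weight in `Λ` of the configuration `ω` of `V`
(its part outside `Λ` being the boundary condition). -/
def weight (Λ : Finset V) (ω : V → F) : ℝ≥0∞ :=
  EReal.exp (∑ b ∈ M.meeting Λ, M.φ b (b.restrict ω))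

theorem weight_ne_top (Λ : Finset V) (ω : V → F) : M.weight Λ ω ≠ ⊤ := by
  classical
  have h : ∀ s : Finset (Finset V), ∑ b ∈ s, M.φ b (b.restrict ω) ≠ ⊤ := by
    intro s
    induction s using Finset.induction_on with
    | empty => simp
    | insert b s hb ih =>
      rw [Finset.sum_insert hb]
      exact EReal.add_ne_top (M.φ_ne_top _ _) ih
  intro hw
  exact h _ (EReal.exp_eq_top_iff.mp hw)

section FiniteVolume

variable [Fintype F]

open Classical in
/-- The normalising factor `Z` for the volume `Λ` and the boundary condition `ω`. -/
def partition (Λ : Finset V) (ω : V → F) : ℝ≥0∞ :=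
  ∑ ξ : Λ → F, M.weight Λ (glue Λ ξ ω)

/-- The probability of `ξ ∈ F^Λ` under the finite-volume Gibbs measure. -/
def gibbsMass (Λ : Finset V) (ω : V → F) (ξ : Λ → F) : ℝ≥0∞ :=
  M.weight Λ (glue Λ ξ ω) / M.partition Λ ω

open Classical in
/-- The finite-volume Gibbs measure on `Λ` with boundary condition `ω`, as a measure on `F^V`
under which the configuration equals `ω` outside `Λ`. -/
def gibbs [MeasurableSpace F] (Λ : Finset V) (ω : V → F) : Measure (V → F) :=
  ∑ ξ : Λ → F, M.gibbsMass Λ ω ξ • Measure.dirac (glue Λ ξ ω)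

theorem isProbabilityMeasure_gibbs [MeasurableSpace F] (Λ : Finset V) (ω : V → F)
    (h : M.partition Λ ω ≠ 0) : IsProbabilityMeasure (M.gibbs Λ ω) := by
  classical
  refine ⟨?_⟩
  have hne : M.partition Λ ω ≠ ⊤ := by
    simp [partition, ENNReal.sum_eq_top, weight_ne_top]
  simp only [gibbs, Measure.coe_finsetSum, Finset.sum_apply, Measure.smul_apply, measure_univ,
    smul_eq_mul, mul_one, gibbsMass, div_eq_mul_inv]
  rw [← Finset.sum_mul]
  exact ENNReal.mul_inv_cancel h hne

/-- The finite-volume Gibbs measure as a point of the space of probability measures on `F^V`. -/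
def gibbsProb [MeasurableSpace F] (Λ : Finset V) (ω : V → F) (h : M.partition Λ ω ≠ 0) :
    ProbabilityMeasure (V → F) :=
  ⟨M.gibbs Λ ω, M.isProbabilityMeasure_gibbs Λ ω h⟩

/-- The set of Gibbs states of the model: probability measures on `F^V` that satisfy the
Dobrushin-Lanford-Ruelle equations. -/
def gibbsStates [MeasurableSpace F] : Set (Measure (V → F)) :=
  {μ | IsProbabilityMeasure μ ∧ ∀ Λ : Finset V,
    (∀ᵐ ω ∂μ, M.partition Λ ω ≠ 0) ∧
    ∀ A : Set (V → F), MeasurableSet A → μ A = ∫⁻ ω, M.gibbs Λ ω A ∂μ}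

/-! ### Overlap and non overlap distributions -/

variable [AddCommGroup G] (val : F ↪ G)

open Classical in
/-- The set of overlap configurations: `∏_{i ∈ Λ} (F + F)`, where `F` is regarded as a
subset of `G` through `val`. -/
def overlapConfigs (Λ : Finset V) : Finset (Λ → G) :=
  Fintype.piFinset fun _ => Finset.univ.image fun a : F × F => val a.1 + val a.2

open Classical in
/-- `ρ(σ)`: the probability that two independent copies of the finite-volume Gibbs measure
have sum `σ`. -/
def overlapMass (Λ : Finset V) (ω : V → F) (σ : Λ → G) : ℝ≥0∞ :=
  ∑ p : (Λ → F) × (Λ → F),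
    if ∀ i, val (p.1 i) + val (p.2 i) = σ i then M.gibbsMass Λ ω p.1 * M.gibbsMass Λ ω p.2 else 0

open Classical in
/-- `μ^σ(ξ)`: the conditional probability that the two copies are `ξ` and `σ - ξ`, given that
their sum is `σ`.  (The sum has one term if `σ - ξ` takes its values in `F`, and none otherwise.) -/
def nonOverlapMass (Λ : Finset V) (ω : V → F) (σ : Λ → G) (ξ : Λ → F) : ℝ≥0∞ :=
  (∑ ξ' : Λ → F,
    if ∀ i, val (ξ i) + val (ξ' i) = σ i then M.gibbsMass Λ ω ξ * M.gibbsMass Λ ω ξ' else 0) /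
    M.overlapMass val Λ ω σ

/-! ### Random cluster representations of the non overlap distribution -/

/-- `Ω(σ) = ∏_{i ∈ Λ} F(σ_i)`, where `F(s)` is the set of `a ∈ F` with `a + c = s` for
some `c ∈ F`. -/
def foldConfigs (Λ : Finset V) (σ : Λ → G) : Set (Λ → F) :=
  {ξ | ∀ i, ∃ c : F, val (ξ i) + val c = σ i}

/-- `Ω_b(σ)`: the local configurations on `b` with values in `F(σ_i)` at the sites `i ∈ Λ`
and equal to the boundary condition `ω` at the sites outside `Λ`. -/
def localConfigs (Λ : Finset V) (ω : V → F) (σ : Λ → G) (b : Finset V) : Set (b → F) :=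
  {ζ | ∀ i : b, (∀ h : i.1 ∈ Λ, ∃ c : F, val (ζ i) + val c = σ ⟨i.1, h⟩) ∧
    (i.1 ∉ Λ → ζ i = ω i)}

/-- The local configuration `ω_b ∈ Ω_b(σ)` of a configuration `ξ ∈ Ω(σ)`, completed by the
boundary condition outside `Λ`. -/
def localRestrict (Λ : Finset V) (ω : V → F) (σ : Λ → G) (ξ : foldConfigs val Λ σ)
    (b : Finset V) : localConfigs val Λ ω σ b :=
  ⟨b.restrict (glue Λ ξ.1 ω), fun i => by
    constructor
    · intro h
      simpa [glue, h] using ξ.2 ⟨i.1, h⟩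
    · intro h
      simp [glue, h]⟩

/-- Hyperbond configurations: for every hyperbond `b` meeting `Λ`, a subset `η_b` of `Ω_b(σ)`. -/
abbrev HyperbondConfig (Λ : Finset V) (ω : V → F) (σ : Λ → G) : Type _ :=
  (b : M.meeting Λ) → Set (localConfigs val Λ ω σ b.1)

variable {Λ : Finset V} {ω : V → F} {σ : Λ → G}

/-- `ξ ∼ η`: for all `b`, the local configuration of `ξ` on `b` belongs to `η_b`. -/
def Compatible (ξ : foldConfigs val Λ σ) (η : M.HyperbondConfig val Λ ω σ) : Prop :=
  ∀ b, localRestrict val Λ ω σ ξ b.1 ∈ η b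

open Classical in
/-- The normalising factor `Z₁` of the random cluster representation with base `ν`. -/
def rcrPartition (ν : PMF (M.HyperbondConfig val Λ ω σ)) : ℝ≥0∞ :=
  ∑ ξ : foldConfigs val Λ σ, ∑ η : M.HyperbondConfig val Λ ω σ,
    ν η * if M.Compatible val ξ η then 1 else 0

open Classical in
/-- The joint distribution `Q` of spins and hyperbond variables. -/
def jointMass (ν : PMF (M.HyperbondConfig val Λ ω σ)) (ξ : foldConfigs val Λ σ)
    (η : M.HyperbondConfig val Λ ω σ) : ℝ≥0∞ :=
  (ν η * if M.Compatible val ξ η then 1 else 0) / M.rcrPartition val ν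

open Classical in
/-- `ν` is the base of a random cluster representation of `μ^σ`: the spin marginal of `Q`
is `μ^σ`. -/
def IsRCR (ν : PMF (M.HyperbondConfig val Λ ω σ)) : Prop :=
  ∀ ξ : foldConfigs val Λ σ,
    M.nonOverlapMass val Λ ω σ ξ.1 =
      ∑ η : M.HyperbondConfig val Λ ω σ, M.jointMass val ν ξ η

/-- `ν` is `σ`-symmetric: almost surely `ζ ∈ η_b` implies `σ_b - ζ ∈ η_b`.  At sites outside `Λ`
both `ζ` and its reflection equal the boundary condition. -/
def IsSymmetricBase (ν : PMF (M.HyperbondConfig val Λ ω σ)) : Prop :=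
  ∀ η, ν η ≠ 0 → ∀ b, ∀ ζ ζ' : localConfigs val Λ ω σ b.1,
    (∀ (i : b.1) (h : i.1 ∈ Λ), val (ζ.1 i) + val (ζ'.1 i) = σ ⟨i.1, h⟩) → ζ ∈ η b → ζ' ∈ η b

open Classical in
/-- The random cluster probability `P^σ`: the marginal of `Q` on hyperbond configurations. -/
def clusterMass (ν : PMF (M.HyperbondConfig val Λ ω σ)) (η : M.HyperbondConfig val Λ ω σ) :
    ℝ≥0∞ :=
  ∑ ξ : foldConfigs val Λ σ, M.jointMass val ν ξ η

/-- The set of active hyperbonds of `η`, those with `η_b ≠ Ω_b(σ)`. -/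
def activeSet (η : M.HyperbondConfig val Λ ω σ) : Set (M.meeting Λ) :=
  {b | η b ≠ Set.univ}

open Classical in
/-- The law of the set of active hyperbonds under `P^σ`. -/
def activeMass (ν : PMF (M.HyperbondConfig val Λ ω σ)) (T : Set (M.meeting Λ)) : ℝ≥0∞ :=
  ∑ η : M.HyperbondConfig val Λ ω σ,
    if M.activeSet val η = T then M.clusterMass val ν η else 0

/-- `A ↔ B` through a set `T` of hyperbonds: a chain of elements of `T`, each
intersecting the next one, begins with a hyperbond meeting `A` and ends with one meeting `B`. -/
def Connected (T : Set (M.meeting Λ)) (A B : Set V) : Prop :=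
  ∃ b ∈ T, ∃ b' ∈ T, (∃ v ∈ b.1, v ∈ A) ∧ (∃ v ∈ b'.1, v ∈ B) ∧
    Relation.ReflTransGen
      (fun c d : M.meeting Λ => c ∈ T ∧ d ∈ T ∧ ∃ v, v ∈ c.1 ∧ v ∈ d.1) b b'

open Classical in
/-- `P^σ(A ↔ B)` by active hyperbonds. -/
def connProb (ν : PMF (M.HyperbondConfig val Λ ω σ)) (A B : Set V) : ℝ≥0∞ :=
  ∑ T : Set (M.meeting Λ), if M.Connected T A B then M.activeMass val ν T else 0

/-- The integrated random cluster distribution on sets of active hyperbonds,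
`P̄ = ∑_σ ρ(σ) (law of the active set under P^σ)`. -/
def integratedMass (ν : (σ : Λ → G) → PMF (M.HyperbondConfig val Λ ω σ))
    (T : Set (M.meeting Λ)) : ℝ≥0∞ :=
  ∑ σ ∈ overlapConfigs val Λ, M.activeMass val (ν σ) T * M.overlapMass val Λ ω σ

open Classical in
/-- `P̄(A ↔ B)` by active hyperbonds. -/
def integratedConnProb (ν : (σ : Λ → G) → PMF (M.HyperbondConfig val Λ ω σ))
    (A B : Set V) : ℝ≥0∞ :=
  ∑ T : Set (M.meeting Λ), if M.Connected T A B then M.integratedMass val ν T else 0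

open Classical in
/-- The `ρ`-probability of a set of overlap configurations. -/
def overlapProb (Λ : Finset V) (ω : V → F) (S : Set (Λ → G)) : ℝ≥0∞ :=
  ∑ σ ∈ overlapConfigs val Λ, if σ ∈ S then M.overlapMass val Λ ω σ else 0

end FiniteVolume

end

end SpinModel

/-!
The extremality of `μ` comes from a reflection argument in finite volume.  Take two independent
copies of the Gibbs measure in `Λ` and condition on their sum `σ`; the copies are then `ξ` and
`σ - ξ`, and `ξ` is the spin marginal of the symmetric random cluster representation.  Given the
hyperbond configuration `η`, the law of `ξ` is uniform on the configurations compatible with `η`.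
If `Λ₀` is not connected to `δΛ₁` by active hyperbonds, the active clusters of `Λ₀` stay inside
`Λ₁`, and replacing `ξ` by `σ - ξ` on them preserves compatibility: an active hyperbond is reflected
as a whole or left alone, and an inactive one imposes nothing.  This interchanges the two copies in
`Λ₀` and leaves both alone off `Λ₁`, so an event `A` in `Λ₀` and an event `B` off `Λ₁` satisfy
`μ_Λ(A ∩ B) ≤ μ_Λ(A) μ_Λ(B) + P̄(Λ₀ ↔ δΛ₁)` (`SpinModel.gibbs_inter_le`).  Alternative (b) bounds
the error term by `2ε` (`SpinModel.integratedConnProb_le`), and the inequality passes to the weak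
limit whenever `A` and `B` are cylinder events.

The limit is a Gibbs state because the specification is local and consistent
(`SpinModel.mem_gibbsStates_of_tendsto`).  For extremality no tail σ-algebra is needed.  Let `ν` be a
Gibbs state with `ν ≤ c μ`, let `A` be an event in `Λ₀`, let `g` be the probability of `A` under the
Gibbs measure in `Λ₁`, as a function of the boundary condition, and let `B = {g > μ(A)}`, which is a
cylinder event off `Λ₁`.  Then
`ν(A) = ∫ g dν ≤ μ(A) + c ∫ (g - μ(A))⁺ dμ = μ(A) + c (μ(A ∩ B) - μ(A) μ(B))`, so that
`ν(A) ≤ μ(A)`; the same for `Aᶜ` gives `ν = μ` (`SpinModel.eq_of_le_smul_of_inter_le`).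
-/

namespace SpinModel

noncomputable section

variable {V F G : Type*} (M : SpinModel V F)

/-! ### Finite-volume Gibbs measures -/

theorem glue_of_mem {Λ : Finset V} {i : V} (h : i ∈ Λ) (ξ : Λ → F) (ω : V → F) :
    glue Λ ξ ω i = ξ ⟨i, h⟩ := by simp [glue, h]

theorem glue_of_notMem {Λ : Finset V} {i : V} (h : i ∉ Λ) (ξ : Λ → F) (ω : V → F) :
    glue Λ ξ ω i = ω i := by simp [glue, h]

theorem mem_meeting {Λ b : Finset V} : b ∈ M.meeting Λ ↔ b ∈ M.bonds ∧ ∃ v ∈ Λ, v ∈ b := by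
  simp [meeting]

section GibbsMass

variable [Fintype F]

theorem partition_ne_top (Λ : Finset V) (ω : V → F) : M.partition Λ ω ≠ ⊤ := by
  simp [partition, ENNReal.sum_eq_top, weight_ne_top]

theorem weight_glue_le_partition (Λ : Finset V) (ω : V → F) (ξ : Λ → F) :
    M.weight Λ (glue Λ ξ ω) ≤ M.partition Λ ω := by
  classical
  unfold partition
  exact Finset.single_le_sum (f := fun ξ => M.weight Λ (glue Λ ξ ω)) (fun _ _ => zero_le)
    (Finset.mem_univ ξ)

theorem gibbsMass_ne_top (Λ : Finset V) (ω : V → F) (ξ : Λ → F) : M.gibbsMass Λ ω ξ ≠ ⊤ :=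
  ne_top_of_le_ne_top ENNReal.one_ne_top
    (ENNReal.div_le_of_le_mul (by simpa using M.weight_glue_le_partition Λ ω ξ))

open Classical in
theorem sum_gibbsMass {Λ : Finset V} {ω : V → F} (h : M.partition Λ ω ≠ 0) :
    ∑ ξ : Λ → F, M.gibbsMass Λ ω ξ = 1 := by
  simp only [gibbsMass, div_eq_mul_inv]
  rw [← Finset.sum_mul]
  exact ENNReal.mul_inv_cancel h (M.partition_ne_top Λ ω)

open Classical in
theorem gibbs_apply [MeasurableSpace F] (Λ : Finset V) (ω : V → F) {A : Set (V → F)}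
    (hA : MeasurableSet A) :
    M.gibbs Λ ω A = ∑ ξ : Λ → F, M.gibbsMass Λ ω ξ * A.indicator 1 (glue Λ ξ ω) := by
  simp [gibbs, Measure.dirac_apply' _ hA]

end GibbsMass

/-! ### Reflection of configurations with a given overlap -/

variable [AddCommGroup G] (val : F ↪ G)

section Reflect

variable {val} {Λ : Finset V} {ω : V → F} {σ : Λ → G}

/-- The reflection `σ - ξ` of a configuration `ξ ∈ Ω(σ)`. -/
def reflect (ξ : foldConfigs val Λ σ) : foldConfigs val Λ σ :=
  ⟨fun i => (ξ.2 i).choose, fun i => ⟨ξ.1 i, by rw [add_comm]; exact (ξ.2 i).choose_spec⟩⟩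

theorem val_add_val_reflect (ξ : foldConfigs val Λ σ) (i : Λ) :
    val (ξ.1 i) + val ((reflect ξ).1 i) = σ i :=
  (ξ.2 i).choose_spec

theorem reflect_apply_eq {ξ : foldConfigs val Λ σ} {i : Λ} {c : F}
    (h : val (ξ.1 i) + val c = σ i) : (reflect ξ).1 i = c := by
  rw [← val_add_val_reflect ξ i] at h
  exact (val.injective (add_left_cancel h)).symm

open Classical in
/-- The configuration that equals `σ - ξ` on the region `R` and `ξ` elsewhere. -/
def reflectOn (R : Set V) (ξ : foldConfigs val Λ σ) : foldConfigs val Λ σ :=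
  ⟨fun i => if i.1 ∈ R then (reflect ξ).1 i else ξ.1 i, fun i => by
    beta_reduce
    split_ifs
    · exact (reflect ξ).2 i
    · exact ξ.2 i⟩

theorem reflectOn_of_mem {R : Set V} {i : Λ} (h : i.1 ∈ R) (ξ : foldConfigs val Λ σ) :
    (reflectOn R ξ).1 i = (reflect ξ).1 i := by simp [reflectOn, h]

theorem reflectOn_of_notMem {R : Set V} {i : Λ} (h : i.1 ∉ R) (ξ : foldConfigs val Λ σ) :
    (reflectOn R ξ).1 i = ξ.1 i := by simp [reflectOn, h]

theorem reflect_reflectOn_of_mem {R : Set V} {i : Λ} (h : i.1 ∈ R) (ξ : foldConfigs val Λ σ) :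
    (reflect (reflectOn R ξ)).1 i = ξ.1 i := by
  apply reflect_apply_eq
  rw [reflectOn_of_mem h, add_comm]
  exact val_add_val_reflect ξ i

theorem reflectOn_involutive (R : Set V) :
    Function.Involutive (reflectOn R : foldConfigs val Λ σ → foldConfigs val Λ σ) := by
  intro ξ
  ext i
  by_cases h : i.1 ∈ R
  · rw [reflectOn_of_mem h, reflect_reflectOn_of_mem h]
  · rw [reflectOn_of_notMem h, reflectOn_of_notMem h]

end Reflect

section Overlap

variable [Fintype F] {Λ : Finset V} {ω : V → F}

open Classical in
/-- Conditioning on the overlap: the double sum over two configurations with overlap `σ` reduces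
to a sum over `ξ ∈ Ω(σ)`, the second configuration being the reflection of `ξ`. -/
theorem overlapMass_mul_sum (σ : Λ → G) (f : (Λ → F) → (Λ → F) → ℝ≥0∞) :
    M.overlapMass val Λ ω σ *
        ∑ ξ : foldConfigs val Λ σ, M.nonOverlapMass val Λ ω σ ξ.1 * f ξ.1 (reflect ξ).1 =
      ∑ ξ : Λ → F, ∑ ξ' : Λ → F, if ∀ i, val (ξ i) + val (ξ' i) = σ i then
        M.gibbsMass Λ ω ξ * M.gibbsMass Λ ω ξ' * f ξ ξ' else 0 := by
  have hle : ∀ ξ : Λ → F, (∑ ξ' : Λ → F, if ∀ i, val (ξ i) + val (ξ' i) = σ i then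
      M.gibbsMass Λ ω ξ * M.gibbsMass Λ ω ξ' else 0) ≤ M.overlapMass val Λ ω σ := by
    intro ξ
    unfold overlapMass
    rw [Fintype.sum_prod_type]
    exact Finset.single_le_sum (f := fun ξ => ∑ ξ' : Λ → F,
      if ∀ i, val (ξ i) + val (ξ' i) = σ i then
        M.gibbsMass Λ ω ξ * M.gibbsMass Λ ω ξ' else 0) (fun _ _ => zero_le) (Finset.mem_univ ξ)
  have htop : M.overlapMass val Λ ω σ ≠ ⊤ := by
    unfold overlapMass
    refine ENNReal.sum_ne_top.2 fun p _ => ?_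
    split_ifs
    · exact ENNReal.mul_ne_top (M.gibbsMass_ne_top _ _ _) (M.gibbsMass_ne_top _ _ _)
    · exact ENNReal.zero_ne_top
  have hmul : ∀ ξ : Λ → F, M.overlapMass val Λ ω σ * M.nonOverlapMass val Λ ω σ ξ =
      ∑ ξ' : Λ → F, if ∀ i, val (ξ i) + val (ξ' i) = σ i then
        M.gibbsMass Λ ω ξ * M.gibbsMass Λ ω ξ' else 0 := by
    intro ξ
    unfold nonOverlapMass
    refine ENNReal.mul_div_cancel' (fun h => ?_) (fun h => absurd h htop)
    exact le_antisymm (h ▸ hle ξ) zero_le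
  rw [Finset.mul_sum]
  refine (Finset.sum_congr_set (foldConfigs val Λ σ) _ _ (fun ξ hξ => ?_) (fun ξ hξ => ?_)).symm
  · rw [← mul_assoc, hmul, Finset.sum_mul]
    refine Finset.sum_congr rfl fun ξ' _ => ?_
    split_ifs with h
    · have : (reflect ⟨ξ, hξ⟩ : foldConfigs val Λ σ).1 = ξ' := by
        ext i
        exact reflect_apply_eq (h i)
      rw [this]
    · simp
  · refine Finset.sum_eq_zero fun ξ' _ => if_neg fun h => hξ fun i => ⟨ξ' i, h i⟩

open Classical in
/-- The law of two independent copies, disintegrated over their overlap. -/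
theorem sum_overlapMass_mul_sum (f : (Λ → F) → (Λ → F) → ℝ≥0∞) :
    ∑ σ ∈ overlapConfigs val Λ, M.overlapMass val Λ ω σ *
        ∑ ξ : foldConfigs val Λ σ, M.nonOverlapMass val Λ ω σ ξ.1 * f ξ.1 (reflect ξ).1 =
      ∑ ξ : Λ → F, ∑ ξ' : Λ → F, M.gibbsMass Λ ω ξ * M.gibbsMass Λ ω ξ' * f ξ ξ' := by
  simp_rw [overlapMass_mul_sum]
  rw [Finset.sum_comm]
  refine Finset.sum_congr rfl fun ξ _ => ?_
  rw [Finset.sum_comm]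
  refine Finset.sum_congr rfl fun ξ' _ => ?_
  rw [Finset.sum_eq_single (fun i => val (ξ i) + val (ξ' i))]
  · simp
  · intro σ _ hσ
    exact if_neg fun h => hσ (funext fun i => (h i).symm)
  · intro h
    refine absurd ?_ h
    simp only [overlapConfigs, Fintype.mem_piFinset, Finset.mem_image]
    exact fun i => ⟨(ξ i, ξ' i), Finset.mem_univ _, rfl⟩

theorem sum_overlapMass (h : M.partition Λ ω ≠ 0) :
    ∑ σ ∈ overlapConfigs val Λ, M.overlapMass val Λ ω σ = 1 := by
  classical
  have h1 := M.sum_gibbsMass h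
  have h2 : ∀ σ : Λ → G, M.overlapMass val Λ ω σ = ∑ ξ : Λ → F, ∑ ξ' : Λ → F,
      if ∀ i, val (ξ i) + val (ξ' i) = σ i then
        M.gibbsMass Λ ω ξ * M.gibbsMass Λ ω ξ' * 1 else 0 := by
    intro σ
    unfold overlapMass
    rw [Fintype.sum_prod_type]
    simp
  simp_rw [h2]
  simp_rw [← M.overlapMass_mul_sum val _ fun _ _ => 1]
  rw [M.sum_overlapMass_mul_sum val fun _ _ => 1]
  simp [← Finset.mul_sum, h1]

open Classical in
theorem sum_nonOverlapMass_le_one (σ : Λ → G) :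
    ∑ ξ : foldConfigs val Λ σ, M.nonOverlapMass val Λ ω σ ξ.1 ≤ 1 := by
  have h : ∑ ξ : foldConfigs val Λ σ, M.nonOverlapMass val Λ ω σ ξ.1 =
      ∑ ξ : Λ → F, M.nonOverlapMass val Λ ω σ ξ := by
    refine (Finset.sum_congr_set (foldConfigs val Λ σ) _ _ (fun ξ hξ => rfl) fun ξ hξ => ?_).symm
    unfold nonOverlapMass
    rw [Finset.sum_eq_zero, ENNReal.zero_div]
    exact fun ξ' _ => if_neg fun h => hξ fun i => ⟨ξ' i, h i⟩
  rw [h]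
  simp only [nonOverlapMass, div_eq_mul_inv]
  rw [← Finset.sum_mul, ← div_eq_mul_inv]
  refine ENNReal.div_le_of_le_mul ?_
  rw [one_mul]
  unfold overlapMass
  rw [Fintype.sum_prod_type]

end Overlap

/-! ### Reflecting the active clusters of a region -/

section Cluster

variable {val} {Λ : Finset V} {ω : V → F} {σ : Λ → G}

/-- The region `A` together with all the vertices connected to it through the set `T` of
hyperbonds. -/
def clusterRegion (T : Set (M.meeting Λ)) (A : Set V) : Set V :=
  A ∪ {v | ∃ b ∈ T, (∃ w ∈ b.1, w ∈ A) ∧ ∃ b' ∈ T, v ∈ b'.1 ∧ Relation.ReflTransGen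
      (fun c d : M.meeting Λ => c ∈ T ∧ d ∈ T ∧ ∃ v, v ∈ c.1 ∧ v ∈ d.1) b b'}

variable {M}

/-- A hyperbond of `T` lies inside the cluster region or is disjoint from it. -/
theorem clusterRegion_dichotomy (T : Set (M.meeting Λ)) (A : Set V) {b : M.meeting Λ}
    (hb : b ∈ T) :
    (∀ v ∈ b.1, v ∈ M.clusterRegion T A) ∨ ∀ v ∈ b.1, v ∉ M.clusterRegion T A := by
  by_contra! h
  obtain ⟨⟨v, hvb, hv⟩, w, hwb, hw⟩ := h
  rcases hw with hw | ⟨c, hc, hcA, d, hd, hwd, hcd⟩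
  · exact hv (Or.inr ⟨b, hb, ⟨w, hwb, hw⟩, b, hb, hvb, .refl⟩)
  · exact hv (Or.inr ⟨c, hc, hcA, b, hb, hvb, hcd.tail ⟨hd, hb, w, hwd, hwb⟩⟩)

theorem clusterRegion_subset {T : Set (M.meeting Λ)} {Λ₀ Λ₁ : Finset V} (h01 : Λ₀ ⊆ Λ₁)
    (hT : ¬ M.Connected T Λ₀ (M.boundary Λ₁)) : M.clusterRegion T Λ₀ ⊆ Λ₁ := by
  rintro v (hv | ⟨b, hb, ⟨w, hwb, hw⟩, c, hc, hvc, hbc⟩)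
  · exact h01 hv
  -- A hyperbond of the cluster that meets `Λ₁` cannot leave it, since it would reach `δΛ₁`.
  have key : ∀ d ∈ T, Relation.ReflTransGen
      (fun c d : M.meeting Λ => c ∈ T ∧ d ∈ T ∧ ∃ v, v ∈ c.1 ∧ v ∈ d.1) b d →
      ∀ x ∈ d.1, x ∈ Λ₁ → ∀ y ∈ d.1, y ∈ Λ₁ := by
    intro d hd hbd x hxd hx y hyd
    by_contra hy
    exact hT ⟨b, hb, d, hd, ⟨w, hwb, hw⟩,
      ⟨x, hxd, d.1, (M.mem_meeting.1 d.2).1, hxd, ⟨x, hxd, hx⟩, y, hyd, hy⟩, hbd⟩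
  have hsub : ∀ d, Relation.ReflTransGen
      (fun c d : M.meeting Λ => c ∈ T ∧ d ∈ T ∧ ∃ v, v ∈ c.1 ∧ v ∈ d.1) b d →
      ∀ y ∈ d.1, y ∈ Λ₁ := by
    intro d hbd
    induction hbd with
    | refl => exact key b hb .refl w hwb (h01 hw)
    | tail h1 h2 ih =>
      obtain ⟨_, hd, x, hx1, hx2⟩ := id h2
      exact key _ hd (h1.tail h2) x hx2 (ih x hx1)
  exact hsub c hbc v hvc

/-- Reflection on a region which no active hyperbond crosses preserves compatibility. -/
theorem compatible_reflectOn {η : M.HyperbondConfig val Λ ω σ}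
    (hη : ∀ b, ∀ ζ ζ' : localConfigs val Λ ω σ b.1,
      (∀ (i : b.1) (h : i.1 ∈ Λ), val (ζ.1 i) + val (ζ'.1 i) = σ ⟨i.1, h⟩) → ζ ∈ η b → ζ' ∈ η b)
    {R : Set V}
    (hR : ∀ b ∈ M.activeSet val η, (∀ v ∈ b.1, v ∈ R) ∨ ∀ v ∈ b.1, v ∉ R)
    {ξ : foldConfigs val Λ σ} (h : M.Compatible val ξ η) :
    M.Compatible val (reflectOn R ξ) η := by
  intro b
  by_cases hb : b ∈ M.activeSet val η
  · rcases hR b hb with hin | hout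
    · refine hη b _ _ (fun i hi => ?_) (h b)
      simp only [localRestrict, Finset.restrict, glue_of_mem hi]
      rw [reflectOn_of_mem (i := ⟨i.1, hi⟩) (hin i.1 i.2)]
      exact val_add_val_reflect ξ _
    · convert h b using 1
      apply Subtype.ext
      ext i
      simp only [localRestrict, Finset.restrict]
      by_cases hi : i.1 ∈ Λ
      · rw [glue_of_mem hi, glue_of_mem hi, reflectOn_of_notMem (i := ⟨i.1, hi⟩) (hout i.1 i.2)]
      · rw [glue_of_notMem hi, glue_of_notMem hi]
  · have : η b = Set.univ := not_not.1 hb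
    rw [this]
    trivial

variable [Fintype F] {ν : PMF (M.HyperbondConfig val Λ ω σ)}

theorem jointMass_reflectOn (hν : M.IsSymmetricBase val ν) {η : M.HyperbondConfig val Λ ω σ}
    {R : Set V}
    (hR : ∀ b ∈ M.activeSet val η, (∀ v ∈ b.1, v ∈ R) ∨ ∀ v ∈ b.1, v ∉ R)
    (ξ : foldConfigs val Λ σ) :
    M.jointMass val ν (reflectOn R ξ) η = M.jointMass val ν ξ η := by
  by_cases h0 : ν η = 0
  · simp [jointMass, h0]
  have : M.Compatible val (reflectOn R ξ) η ↔ M.Compatible val ξ η :=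
    ⟨fun h => reflectOn_involutive R ξ ▸ compatible_reflectOn (hν η h0) hR h,
      compatible_reflectOn (hν η h0) hR⟩
  by_cases hc : M.Compatible val ξ η
  · simp [jointMass, hc, this.2 hc]
  · simp [jointMass, hc, mt this.1 hc]

open Classical in
theorem connProb_eq (A B : Set V) :
    M.connProb val ν A B = ∑ η : M.HyperbondConfig val Λ ω σ,
      if M.Connected (M.activeSet val η) A B then M.clusterMass val ν η else 0 := by
  unfold connProb activeMass
  have h : ∀ T : Set (M.meeting Λ), (if M.Connected T A B then
      ∑ η : M.HyperbondConfig val Λ ω σ,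
        if M.activeSet val η = T then M.clusterMass val ν η else 0 else 0) =
      ∑ η : M.HyperbondConfig val Λ ω σ, if M.activeSet val η = T then
        (if M.Connected T A B then M.clusterMass val ν η else 0) else 0 := by
    intro T
    split_ifs <;> simp
  simp_rw [h]
  rw [Finset.sum_comm]
  simp

open Classical in
theorem integratedConnProb_eq (ν : (σ : Λ → G) → PMF (M.HyperbondConfig val Λ ω σ))
    (A B : Set V) :
    M.integratedConnProb val ν A B =
      ∑ σ ∈ overlapConfigs val Λ, M.overlapMass val Λ ω σ * M.connProb val (ν σ) A B := by
  unfold integratedConnProb integratedMass connProb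
  simp_rw [Finset.mul_sum]
  rw [Finset.sum_comm]
  refine Finset.sum_congr rfl fun T _ => ?_
  split_ifs
  · simp [mul_comm]
  · simp

open Classical in
/-- Given the overlap `σ`, and unless `Λ₀` is connected to `δΛ₁` by active hyperbonds, an event
in `Λ₀` may be tested on the reflected configuration and an event off `Λ₁` on the original one:
reflecting the active clusters of `Λ₀` preserves the joint law of spins and hyperbonds. -/
theorem sum_nonOverlapMass_inter_le (hν : M.IsRCR val ν) (hs : M.IsSymmetricBase val ν)
    {Λ₀ Λ₁ : Finset V} (h01 : Λ₀ ⊆ Λ₁) (h1 : Λ₁ ⊆ Λ) {A B : Set (V → F)}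
    (hA : DependsOn (· ∈ A) (Λ₀ : Set V)) (hB : DependsOn (· ∈ B) (Λ₁ : Set V)ᶜ) :
    ∑ ξ : foldConfigs val Λ σ, M.nonOverlapMass val Λ ω σ ξ.1 *
        (A.indicator 1 (glue Λ ξ.1 ω) * B.indicator 1 (glue Λ ξ.1 ω)) ≤
      ∑ ξ : foldConfigs val Λ σ, M.nonOverlapMass val Λ ω σ ξ.1 *
        (A.indicator 1 (glue Λ (reflect ξ).1 ω) * B.indicator 1 (glue Λ ξ.1 ω)) +
      M.connProb val ν Λ₀ (M.boundary Λ₁) := by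
  have hν' : ∀ ξ : foldConfigs val Λ σ, M.nonOverlapMass val Λ ω σ ξ.1 =
      ∑ η : M.HyperbondConfig val Λ ω σ, M.jointMass val ν ξ η := hν
  simp_rw [hν', Finset.sum_mul]
  rw [connProb_eq, Finset.sum_comm, Finset.sum_comm (s := Finset.univ (α := foldConfigs val Λ σ)),
    ← Finset.sum_add_distrib]
  refine Finset.sum_le_sum fun η _ => ?_
  split_ifs with hc
  · refine le_add_left (Finset.sum_le_sum fun ξ _ => ?_)
    refine mul_le_of_le_one_right' (mul_le_one' ?_ ?_) <;>
    exact Set.indicator_le_self' (by simp) _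
  · rw [add_zero]
    have hR : ∀ b ∈ M.activeSet val η,
        (∀ v ∈ b.1, v ∈ M.clusterRegion (M.activeSet val η) (Λ₀ : Set V)) ∨
        ∀ v ∈ b.1, v ∉ M.clusterRegion (M.activeSet val η) (Λ₀ : Set V) :=
      fun b hb => clusterRegion_dichotomy _ _ hb
    have hsub := clusterRegion_subset h01 hc
    set R := M.clusterRegion (M.activeSet val η) (Λ₀ : Set V) with hRdef
    refine (Fintype.sum_equiv (reflectOn_involutive R).toPerm _ _ fun ξ => ?_).le
    simp only [Function.Involutive.coe_toPerm, jointMass_reflectOn hs hR]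
    have e1 : (glue Λ (reflect (reflectOn R ξ)).1 ω ∈ A) = (glue Λ ξ.1 ω ∈ A) := by
      refine hA fun i hi => ?_
      have hiΛ : i ∈ Λ := h1 (h01 hi)
      rw [glue_of_mem hiΛ, glue_of_mem hiΛ,
        reflect_reflectOn_of_mem (i := ⟨i, hiΛ⟩) (Or.inl hi : i ∈ R)]
    have e2 : (glue Λ (reflectOn R ξ).1 ω ∈ B) = (glue Λ ξ.1 ω ∈ B) := by
      refine hB fun i hi => ?_
      by_cases hiΛ : i ∈ Λ
      · rw [glue_of_mem hiΛ, glue_of_mem hiΛ,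
          reflectOn_of_notMem (i := ⟨i, hiΛ⟩) fun h => hi (hsub h)]
      · rw [glue_of_notMem hiΛ, glue_of_notMem hiΛ]
    simp only [Set.indicator_apply, e1, e2, Pi.one_apply]

theorem connProb_le_one (hν : M.IsRCR val ν) (A B : Set V) : M.connProb val ν A B ≤ 1 := by
  classical
  rw [connProb_eq]
  calc _ ≤ ∑ η : M.HyperbondConfig val Λ ω σ, M.clusterMass val ν η :=
        Finset.sum_le_sum fun η _ => by split_ifs <;> simp
    _ = ∑ ξ : foldConfigs val Λ σ, M.nonOverlapMass val Λ ω σ ξ.1 := by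
        unfold clusterMass
        rw [Finset.sum_comm]
        exact Finset.sum_congr rfl fun ξ _ => (hν ξ).symm
    _ ≤ 1 := M.sum_nonOverlapMass_le_one val σ

/-- Approximate independence in finite volume: events in `Λ₀` and off `Λ₁` are correlated at most
by the probability that `Λ₀` is connected to `δΛ₁` in the integrated random cluster
distribution. -/
theorem gibbs_inter_le [MeasurableSpace F] (hZ : M.partition Λ ω ≠ 0)
    {ν : (σ : Λ → G) → PMF (M.HyperbondConfig val Λ ω σ)}
    (hν : ∀ σ : Λ → G, M.overlapMass val Λ ω σ ≠ 0 →
      M.IsRCR val (ν σ) ∧ M.IsSymmetricBase val (ν σ))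
    {Λ₀ Λ₁ : Finset V} (h01 : Λ₀ ⊆ Λ₁) (h1 : Λ₁ ⊆ Λ) {A B : Set (V → F)}
    (hA : DependsOn (· ∈ A) (Λ₀ : Set V)) (hB : DependsOn (· ∈ B) (Λ₁ : Set V)ᶜ)
    (hAm : MeasurableSet A) (hBm : MeasurableSet B) :
    M.gibbs Λ ω (A ∩ B) ≤ M.gibbs Λ ω A * M.gibbs Λ ω B +
      M.integratedConnProb val ν Λ₀ (M.boundary Λ₁) := by
  classical
  have e1 : M.gibbs Λ ω (A ∩ B) = ∑ ξ : Λ → F, ∑ ξ' : Λ → F,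
      M.gibbsMass Λ ω ξ * M.gibbsMass Λ ω ξ' *
        (A.indicator 1 (glue Λ ξ ω) * B.indicator 1 (glue Λ ξ ω)) := by
    rw [M.gibbs_apply _ _ (hAm.inter hBm)]
    refine Finset.sum_congr rfl fun ξ _ => ?_
    rw [← Finset.sum_mul, ← Finset.mul_sum, M.sum_gibbsMass hZ, mul_one, Set.inter_indicator_one]
    rfl
  have e2 : M.gibbs Λ ω A * M.gibbs Λ ω B = ∑ ξ : Λ → F, ∑ ξ' : Λ → F,
      M.gibbsMass Λ ω ξ * M.gibbsMass Λ ω ξ' *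
        (A.indicator 1 (glue Λ ξ' ω) * B.indicator 1 (glue Λ ξ ω)) := by
    rw [M.gibbs_apply _ _ hAm, M.gibbs_apply _ _ hBm, mul_comm, Finset.sum_mul_sum]
    refine Finset.sum_congr rfl fun ξ _ => Finset.sum_congr rfl fun ξ' _ => ?_
    ring
  rw [e1, e2, ← M.sum_overlapMass_mul_sum val fun ξ _ =>
      A.indicator 1 (glue Λ ξ ω) * B.indicator 1 (glue Λ ξ ω),
    ← M.sum_overlapMass_mul_sum val fun ξ ξ' =>
      A.indicator 1 (glue Λ ξ' ω) * B.indicator 1 (glue Λ ξ ω),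
    integratedConnProb_eq, ← Finset.sum_add_distrib]
  refine Finset.sum_le_sum fun σ _ => ?_
  by_cases h0 : M.overlapMass val Λ ω σ = 0
  · simp [h0]
  rw [← mul_add]
  gcongr
  exact sum_nonOverlapMass_inter_le (hν σ h0).1 (hν σ h0).2 h01 h1 hA hB

/-- If the connection probability is at most `ε` for all overlaps outside a set of probability at
most `ε`, then the integrated connection probability is at most `2ε`. -/
theorem integratedConnProb_le (hZ : M.partition Λ ω ≠ 0)
    {ν : (σ : Λ → G) → PMF (M.HyperbondConfig val Λ ω σ)}
    (hν : ∀ σ : Λ → G, M.overlapMass val Λ ω σ ≠ 0 → M.IsRCR val (ν σ))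
    {A B : Set V} {ε : ℝ≥0∞}
    (h : 1 - ε ≤ M.overlapProb val Λ ω {σ | M.connProb val (ν σ) A B ≤ ε}) :
    M.integratedConnProb val ν A B ≤ ε + ε := by
  classical
  set S := {σ : Λ → G | M.connProb val (ν σ) A B ≤ ε} with hS
  have hsum := M.sum_overlapMass val hZ
  have hsplit : M.overlapProb val Λ ω S + M.overlapProb val Λ ω Sᶜ = 1 := by
    rw [← hsum, overlapProb, overlapProb, ← Finset.sum_add_distrib]
    refine Finset.sum_congr rfl fun σ _ => ?_
    by_cases hσ : σ ∈ S <;> simp [hσ]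
  have hbad : M.overlapProb val Λ ω Sᶜ ≤ ε := by
    have hfin : M.overlapProb val Λ ω S ≠ ⊤ := by
      intro h; simp [h] at hsplit
    rw [tsub_le_iff_right, ← hsplit] at h
    exact (ENNReal.add_le_add_iff_left hfin).1 h
  rw [integratedConnProb_eq]
  calc _ ≤ ∑ σ ∈ overlapConfigs val Λ, (M.overlapMass val Λ ω σ * ε +
        if σ ∈ Sᶜ then M.overlapMass val Λ ω σ else 0) := by
        refine Finset.sum_le_sum fun σ _ => ?_
        by_cases h0 : M.overlapMass val Λ ω σ = 0
        · simp [h0]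
        by_cases hσ : σ ∈ S
        · exact le_add_right (mul_le_mul_right hσ _)
        · rw [if_pos (show σ ∈ Sᶜ from hσ)]
          exact le_add_left (mul_le_of_le_one_right' (connProb_le_one (hν σ h0) A B))
    _ = ε + M.overlapProb val Λ ω Sᶜ := by
        rw [Finset.sum_add_distrib, ← Finset.sum_mul, hsum, one_mul, overlapProb]
        -- The two sums differ in their decidability instances only.
        congr!
    _ ≤ ε + ε := by gcongr

end Cluster

end

end SpinModel

/-! ### Functions of finitely many spins -/

section Local

variable {V F : Type*}

theorem DependsOn.isLocallyConstant [TopologicalSpace F] [DiscreteTopology F] {β : Type*}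
    {f : (V → F) → β} {S : Finset V} (hf : DependsOn f (S : Set V)) : IsLocallyConstant f := by
  rw [IsLocallyConstant.iff_exists_open]
  intro x
  refine ⟨(S : Set V).pi fun i => {x i}, isOpen_set_pi S.finite_toSet fun _ _ => isOpen_discrete _,
    fun _ _ => rfl, fun y hy => hf fun i hi => hy i hi⟩

/-- Two measures on configurations agree if they agree on cylinder events. -/
theorem MeasureTheory.Measure.ext_of_dependsOn [MeasurableSpace F] {μ ν : Measure (V → F)}
    [IsFiniteMeasure μ]
    (h : ∀ (S : Finset V) (A : Set (V → F)), MeasurableSet A → DependsOn (· ∈ A) (S : Set V) →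
      μ A = ν A) : μ = ν := by
  refine ext_of_generate_finite (measurableCylinders fun _ : V => F)
    generateFrom_measurableCylinders.symm isPiSystem_measurableCylinders (fun A hA => ?_)
    (h ∅ _ .univ fun _ _ _ => rfl)
  have hAm := MeasurableSet.of_mem_measurableCylinders hA
  obtain ⟨s, T, -, rfl⟩ := (mem_measurableCylinders A).1 hA
  refine h s _ hAm fun x y hxy => ?_
  have : s.restrict x = s.restrict y := funext fun i => hxy i i.2
  simp only [mem_cylinder, this]

variable [Countable V] [Finite F] [TopologicalSpace F] [DiscreteTopology F] [MeasurableSpace F]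
  [BorelSpace F]

theorem DependsOn.measurableSet {A : Set (V → F)} {S : Finset V}
    (hA : DependsOn (· ∈ A) (S : Set V)) : MeasurableSet A := by
  have := hA.isLocallyConstant.isOpen_fiber True
  simp only [eq_iff_iff, iff_true, Set.ofPred_mem_eq] at this
  exact this.measurableSet

theorem DependsOn.tendsto_lintegral {ι : Type*} {l : Filter ι} {P : ι → ProbabilityMeasure (V → F)}
    {μ : ProbabilityMeasure (V → F)} (h : Tendsto P l (𝓝 μ)) {f : (V → F) → ℝ≥0∞} {S : Finset V}
    (hf : DependsOn f (S : Set V)) (hfin : ∀ x, f x ≠ ⊤) :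
    Tendsto (fun n => ∫⁻ x, f x ∂(P n : Measure (V → F))) l
      (𝓝 (∫⁻ x, f x ∂(μ : Measure (V → F)))) := by
  have hc : Continuous fun x => (f x).toNNReal :=
    (hf.isLocallyConstant.comp ENNReal.toNNReal).continuous
  have := ProbabilityMeasure.tendsto_iff_forall_lintegral_tendsto.1 h
    (BoundedContinuousFunction.mkOfCompact ⟨_, hc⟩)
  simpa [ENNReal.coe_toNNReal (hfin _)] using this

theorem DependsOn.tendsto_measure {ι : Type*} {l : Filter ι} {P : ι → ProbabilityMeasure (V → F)}
    {μ : ProbabilityMeasure (V → F)} (h : Tendsto P l (𝓝 μ)) {A : Set (V → F)} {S : Finset V}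
    (hA : DependsOn (· ∈ A) (S : Set V)) :
    Tendsto (fun n => (P n : Measure (V → F)) A) l (𝓝 ((μ : Measure (V → F)) A)) := by
  have hd : DependsOn (A.indicator (1 : (V → F) → ℝ≥0∞)) (S : Set V) := by
    classical
    intro x y hxy
    have : (x ∈ A) = (y ∈ A) := hA hxy
    simp only [Set.indicator_apply, this, Pi.one_apply]
  have := hd.tendsto_lintegral h fun x => ne_top_of_le_ne_top ENNReal.one_ne_top
    (Set.indicator_le_self' (by simp) x)
  simpa only [lintegral_indicator_one hA.measurableSet] using this

end Local

namespace SpinModel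

noncomputable section

variable {V F : Type*} (M : SpinModel V F)

/-! ### Locality of the Gibbs specification -/

open Classical in
/-- The vertices of the hyperbonds meeting `Λ`, on which the Gibbs weight in `Λ` depends. -/
def vicinity (Λ : Finset V) : Finset V := (M.meeting Λ).biUnion id

theorem dependsOn_weight (Λ : Finset V) : DependsOn (M.weight Λ) (M.vicinity Λ : Set V) := by
  classical
  intro x y hxy
  unfold weight
  congr 1
  refine Finset.sum_congr rfl fun b hb => ?_
  congr 1
  ext i
  exact hxy i.1 (Finset.mem_coe.2 (Finset.mem_biUnion.2 ⟨b, hb, i.2⟩))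

theorem dependsOn_comp_glue {β : Type*} {f : (V → F) → β} {S : Set V} (hf : DependsOn f S)
    (Λ : Finset V) (ξ : Λ → F) : DependsOn (fun ω => f (glue Λ ξ ω)) (S \ Λ) := by
  intro x y hxy
  refine hf fun i hi => ?_
  by_cases h : i ∈ Λ
  · rw [glue_of_mem h, glue_of_mem h]
  · rw [glue_of_notMem h, glue_of_notMem h]
    exact hxy i ⟨hi, h⟩

/-- Over a larger volume the Gibbs weight acquires a factor which ignores the spins in `Λ`. -/
theorem exists_weight_eq_mul {Λ Λ' : Finset V} (h : Λ ⊆ Λ') :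
    ∃ r : (V → F) → ℝ≥0∞, DependsOn r (Λ : Set V)ᶜ ∧
      ∀ x, M.weight Λ' x = M.weight Λ x * r x := by
  classical
  refine ⟨fun x => EReal.exp (∑ b ∈ M.meeting Λ' \ M.meeting Λ, M.φ b (b.restrict x)), ?_, ?_⟩
  · intro x y hxy
    beta_reduce
    congr 1
    refine Finset.sum_congr rfl fun b hb => ?_
    congr 1
    ext i
    refine hxy i.1 fun hi => ?_
    rw [Finset.mem_sdiff, mem_meeting, mem_meeting] at hb
    exact hb.2 ⟨hb.1.1, i.1, hi, i.2⟩
  · intro x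
    have hsub : M.meeting Λ ⊆ M.meeting Λ' := by
      intro b hb
      rw [mem_meeting] at hb ⊢
      obtain ⟨hb, v, hv, hvb⟩ := hb
      exact ⟨hb, v, h hv, hvb⟩
    rw [weight, weight, ← EReal.exp_add, add_comm, Finset.sum_sdiff hsub]

variable [Fintype F]

theorem dependsOn_partition (Λ : Finset V) :
    DependsOn (M.partition Λ) ((M.vicinity Λ : Set V) \ Λ) := by
  intro x y hxy
  unfold partition
  exact Finset.sum_congr rfl fun ξ _ => dependsOn_comp_glue (M.dependsOn_weight Λ) Λ ξ hxy

theorem dependsOn_gibbsMass (Λ : Finset V) (ξ : Λ → F) :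
    DependsOn (fun ω => M.gibbsMass Λ ω ξ) ((M.vicinity Λ : Set V) \ Λ) := by
  intro x y hxy
  have h1 := M.dependsOn_partition Λ hxy
  have h2 := dependsOn_comp_glue (M.dependsOn_weight Λ) Λ ξ hxy
  beta_reduce at h2 ⊢
  rw [gibbsMass, gibbsMass, h1, h2]

variable [MeasurableSpace F]

theorem dependsOn_gibbs (Λ : Finset V) {A : Set (V → F)} {S : Set V}
    (hA : DependsOn (· ∈ A) S) (hAm : MeasurableSet A) :
    DependsOn (fun ω => M.gibbs Λ ω A) ((M.vicinity Λ ∪ S : Set V) \ Λ) := by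
  classical
  intro x y hxy
  simp only [gibbs_apply _ _ _ hAm]
  refine Finset.sum_congr rfl fun ξ _ => ?_
  have h1 := M.dependsOn_gibbsMass Λ ξ fun i hi => hxy i ⟨Or.inl hi.1, hi.2⟩
  have h2 := dependsOn_comp_glue hA Λ ξ fun i hi => hxy i ⟨Or.inr hi.1, hi.2⟩
  beta_reduce at h1 h2
  simp only [h1, Set.indicator_apply, h2, Pi.one_apply]

theorem gibbs_ne_top (Λ : Finset V) (ω : V → F) {A : Set (V → F)} (hA : MeasurableSet A) :
    M.gibbs Λ ω A ≠ ⊤ := by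
  classical
  rw [gibbs_apply _ _ _ hA]
  exact ENNReal.sum_ne_top.2 fun ξ _ => ENNReal.mul_ne_top (M.gibbsMass_ne_top _ _ _)
    (ne_top_of_le_ne_top ENNReal.one_ne_top (Set.indicator_le_self' (by simp) _))

/-- Under the finite-volume Gibbs measure an event off `Λ` is decided by the boundary condition. -/
theorem gibbs_inter_of_dependsOn_compl (Λ : Finset V) (ω : V → F) {A B : Set (V → F)}
    (hB : DependsOn (· ∈ B) (Λ : Set V)ᶜ) (hAm : MeasurableSet A) (hBm : MeasurableSet B) :
    M.gibbs Λ ω (A ∩ B) = B.indicator (fun ω => M.gibbs Λ ω A) ω := by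
  classical
  rw [gibbs_apply _ _ _ (hAm.inter hBm), Set.indicator_apply, gibbs_apply _ _ _ hAm]
  have h : ∀ ξ : Λ → F, (glue Λ ξ ω ∈ B) = (ω ∈ B) := fun ξ =>
    hB fun i hi => glue_of_notMem hi ξ ω
  split_ifs with hω
  · refine Finset.sum_congr rfl fun ξ _ => ?_
    simp only [Set.indicator_apply, Set.mem_inter_iff, h, hω, and_true]
  · refine Finset.sum_eq_zero fun ξ _ => ?_
    simp only [Set.indicator_apply, Set.mem_inter_iff, h, hω, and_false, if_false, mul_zero]

open Classical in
theorem lintegral_gibbs (Λ : Finset V) (ω : V → F) {f : (V → F) → ℝ≥0∞} (hf : Measurable f) :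
    ∫⁻ x, f x ∂M.gibbs Λ ω = ∑ ξ : Λ → F, M.gibbsMass Λ ω ξ * f (glue Λ ξ ω) := by
  simp only [gibbs, lintegral_finsetSum_measure, lintegral_smul_measure, lintegral_dirac' _ hf,
    smul_eq_mul]

open Classical in
/-- Resampling the spins in `Λ` preserves the Gibbs weights of a larger volume `Λ'`. -/
theorem sum_weight_mul_gibbs {Λ Λ' : Finset V} (h : Λ ⊆ Λ') (ω : V → F) {A : Set (V → F)}
    (hA : MeasurableSet A) :
    ∑ ξ : Λ' → F, M.weight Λ' (glue Λ' ξ ω) * M.gibbs Λ (glue Λ' ξ ω) A =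
      ∑ ξ : Λ' → F, M.weight Λ' (glue Λ' ξ ω) * A.indicator 1 (glue Λ' ξ ω) := by
  obtain ⟨r, hr, hw⟩ := M.exists_weight_eq_mul h
  -- Exchange the spins of `ξ` in `Λ` with those of the resampled configuration `ζ`.
  let e : (Λ' → F) × (Λ → F) → (Λ' → F) × (Λ → F) := fun p =>
    (fun i => glue Λ p.2 (glue Λ' p.1 ω) i.1, fun i => p.1 ⟨i.1, h i.2⟩)
  have he1 : ∀ p, glue Λ' (e p).1 ω = glue Λ p.2 (glue Λ' p.1 ω) := by
    intro p
    ext i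
    by_cases hi' : i ∈ Λ'
    · rw [glue_of_mem hi']
    · rw [glue_of_notMem hi', glue_of_notMem (fun hi => hi' (h hi)), glue_of_notMem hi']
  have he2 : ∀ p, glue Λ (e p).2 (glue Λ' (e p).1 ω) = glue Λ' p.1 ω := by
    intro p
    rw [he1]
    ext i
    by_cases hi : i ∈ Λ
    · rw [glue_of_mem hi, glue_of_mem (h hi)]
    · rw [glue_of_notMem hi, glue_of_notMem hi]
  have hinv : Function.Involutive e := by
    intro p
    have h2 := he2 p
    refine Prod.ext (funext fun i => ?_) (funext fun i => ?_)
    · change glue Λ (e p).2 (glue Λ' (e p).1 ω) i.1 = _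
      rw [h2, glue_of_mem i.2]
    · change glue Λ p.2 (glue Λ' p.1 ω) i.1 = _
      rw [glue_of_mem i.2]
  have hglue : ∀ (ζ : Λ → F) (x : V → F), ∀ i ∈ (Λ : Set V)ᶜ, glue Λ ζ x i = x i :=
    fun ζ x i hi => glue_of_notMem hi ζ x
  let T : (Λ' → F) × (Λ → F) → ℝ≥0∞ := fun p =>
    M.weight Λ' (glue Λ' p.1 ω) * (M.gibbsMass Λ (glue Λ' p.1 ω) p.2 *
      A.indicator 1 (glue Λ p.2 (glue Λ' p.1 ω)))
  have hT : ∀ p, T (e p) = M.weight Λ (glue Λ p.2 (glue Λ' p.1 ω)) * r (glue Λ' p.1 ω) *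
      (M.weight Λ (glue Λ' p.1 ω) / M.partition Λ (glue Λ' p.1 ω) *
        A.indicator 1 (glue Λ' p.1 ω)) := by
    intro p
    simp only [T, gibbsMass, he2]
    rw [he1, hw, hr (hglue p.2 (glue Λ' p.1 ω)),
      M.dependsOn_partition Λ fun i hi => hglue p.2 (glue Λ' p.1 ω) i hi.2]
  calc _ = ∑ p, T p := by
        rw [Fintype.sum_prod_type]
        refine Finset.sum_congr rfl fun ξ _ => ?_
        rw [gibbs_apply _ _ _ hA, Finset.mul_sum]
    _ = ∑ p, T (e p) := (Equiv.sum_comp hinv.toPerm T).symm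
    _ = _ := by
        simp_rw [hT]
        rw [Fintype.sum_prod_type]
        refine Finset.sum_congr rfl fun ξ _ => ?_
        dsimp only
        rw [← Finset.sum_mul, ← Finset.sum_mul]
        change M.partition Λ (glue Λ' ξ ω) * _ * _ = _
        rw [hw]
        have hle : M.weight Λ (glue Λ' ξ ω) ≤ M.partition Λ (glue Λ' ξ ω) := by
          convert M.weight_glue_le_partition Λ (glue Λ' ξ ω) (fun i => ξ ⟨i.1, h i.2⟩) using 2
          ext i
          by_cases hi : i ∈ Λ
          · rw [glue_of_mem hi, glue_of_mem (h hi)]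
          · rw [glue_of_notMem hi]
        have hcancel : M.partition Λ (glue Λ' ξ ω) *
            (M.weight Λ (glue Λ' ξ ω) / M.partition Λ (glue Λ' ξ ω)) =
            M.weight Λ (glue Λ' ξ ω) :=
          ENNReal.mul_div_cancel' (fun h0 => le_antisymm (h0 ▸ hle) zero_le)
            fun htop => absurd htop (M.partition_ne_top _ _)
        calc _ = (M.partition Λ (glue Λ' ξ ω) *
            (M.weight Λ (glue Λ' ξ ω) / M.partition Λ (glue Λ' ξ ω))) * r (glue Λ' ξ ω) *
              A.indicator 1 (glue Λ' ξ ω) := by ring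
          _ = _ := by rw [hcancel]

theorem measurable_gibbs_apply [Countable V] [TopologicalSpace F] [DiscreteTopology F]
    [BorelSpace F] (Λ : Finset V) {A : Set (V → F)} (hA : MeasurableSet A) :
    Measurable fun ω => M.gibbs Λ ω A := by
  classical
  simp only [gibbs_apply _ _ _ hA]
  refine Finset.measurable_sum _ fun ξ _ => Measurable.mul ?_ ?_
  · have hd := (M.dependsOn_gibbsMass Λ ξ).mono (t := (M.vicinity Λ : Set V)) Set.sdiff_subset
    exact hd.isLocallyConstant.continuous.measurable
  · refine (measurable_one.indicator hA).comp (measurable_pi_lambda _ fun i => ?_)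
    by_cases hi : i ∈ Λ
    · simp only [glue_of_mem hi, measurable_const]
    · simp only [glue_of_notMem hi, measurable_pi_apply]

/-- Consistency of the finite-volume Gibbs measures. -/
theorem lintegral_gibbs_gibbs [Countable V] [TopologicalSpace F] [DiscreteTopology F]
    [BorelSpace F] {Λ Λ' : Finset V} (h : Λ ⊆ Λ') (ω : V → F) {A : Set (V → F)}
    (hA : MeasurableSet A) : ∫⁻ x, M.gibbs Λ x A ∂M.gibbs Λ' ω = M.gibbs Λ' ω A := by
  classical
  rw [lintegral_gibbs _ _ _ (M.measurable_gibbs_apply Λ hA), gibbs_apply _ _ _ hA]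
  have := congrArg (· / M.partition Λ' ω) (M.sum_weight_mul_gibbs h ω hA)
  simp only [div_eq_mul_inv, Finset.sum_mul] at this
  simp only [gibbsMass, div_eq_mul_inv]
  simpa only [mul_right_comm] using this

theorem gibbs_weight_eq_zero {Λ Λ' : Finset V} (h : Λ ⊆ Λ') (ω : V → F)
    (hm : MeasurableSet {x | M.weight Λ x = 0}) : M.gibbs Λ' ω {x | M.weight Λ x = 0} = 0 := by
  classical
  obtain ⟨r, -, hw⟩ := M.exists_weight_eq_mul h
  rw [gibbs_apply _ _ _ hm]
  refine Finset.sum_eq_zero fun ξ _ => ?_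
  rw [Set.indicator_apply]
  split_ifs with h0
  · have h0' : M.weight Λ (glue Λ' ξ ω) = 0 := h0
    simp [gibbsMass, hw, h0']
  · simp

/-! ### Weak limits of finite-volume Gibbs measures -/

variable [Countable V] [TopologicalSpace F] [DiscreteTopology F] [BorelSpace F]
variable {M}

/-- A weak limit of finite-volume Gibbs measures is a Gibbs state: the specification is local, hence
the equations of Dobrushin, Lanford and Ruelle pass to the limit on cylinder events. -/
theorem mem_gibbsStates_of_tendsto {Λ : ℕ → Finset V} (hΛ : Tendsto Λ atTop atTop)
    {ω : ℕ → V → F} (hω : ∀ n, M.partition (Λ n) (ω n) ≠ 0) {μ : ProbabilityMeasure (V → F)}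
    (hμ : Tendsto (fun n => M.gibbsProb (Λ n) (ω n) (hω n)) atTop (𝓝 μ)) :
    (μ : Measure (V → F)) ∈ M.gibbsStates := by
  classical
  refine ⟨inferInstance, fun Δ => ?_⟩
  have hlarge : ∀ᶠ n in atTop, Δ ⊆ Λ n := hΛ.eventually_ge_atTop Δ
  have hw : DependsOn (· ∈ {x | M.weight Δ x = 0}) (M.vicinity Δ : Set V) := by
    intro x y hxy
    simp only [Set.mem_ofPred_eq, M.dependsOn_weight Δ hxy]
  have h0 : (μ : Measure (V → F)) {x | M.weight Δ x = 0} = 0 := by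
    refine tendsto_nhds_unique (hw.tendsto_measure hμ)
      (tendsto_const_nhds.congr' (hlarge.mono fun n hn => ?_))
    exact (M.gibbs_weight_eq_zero hn (ω n) hw.measurableSet).symm
  have hZ : ∀ᵐ x ∂(μ : Measure (V → F)), M.partition Δ x ≠ 0 := by
    refine (measure_eq_zero_iff_ae_notMem.1 h0).mono fun x hx hx0 => hx ?_
    have := M.weight_glue_le_partition Δ x (fun i => x i.1)
    have hglue : glue Δ (fun i => x i.1) x = x := by
      ext i
      by_cases hi : i ∈ Δ
      · rw [glue_of_mem hi]
      · rw [glue_of_notMem hi]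
    rw [hglue, hx0] at this
    exact le_antisymm this zero_le
  refine ⟨hZ, ?_⟩
  have hmeas : Measurable (M.gibbs Δ) :=
    Measure.measurable_of_measurable_coe _ fun A hA => M.measurable_gibbs_apply Δ hA
  have hbind : (μ : Measure (V → F)) = (μ : Measure (V → F)).bind (M.gibbs Δ) := by
    refine Measure.ext_of_dependsOn fun S A hAm hA => ?_
    rw [Measure.bind_apply hAm hmeas.aemeasurable]
    have hd : DependsOn (fun x => M.gibbs Δ x A) ((M.vicinity Δ ∪ S : Finset V) : Set V) := by
      rw [Finset.coe_union]
      exact (M.dependsOn_gibbs Δ hA hAm).mono Set.sdiff_subset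
    refine tendsto_nhds_unique (hA.tendsto_measure hμ)
      ((hd.tendsto_lintegral hμ fun x => M.gibbs_ne_top Δ x hAm).congr' ?_)
    exact hlarge.mono fun n hn => M.lintegral_gibbs_gibbs hn (ω n) hAm
  intro A hA
  rw [← Measure.bind_apply hA hmeas.aemeasurable, ← hbind]

/-! ### Extremality from asymptotic independence -/

/-- A Gibbs state `ν` dominated by a multiple of a Gibbs state `μ` equals `μ`, if `μ` has decaying
correlations between events in a finite region and far away events. -/
theorem eq_of_le_smul_of_inter_le {μ ν : Measure (V → F)} (hμ : μ ∈ M.gibbsStates)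
    (hν : ν ∈ M.gibbsStates) {c : ℝ≥0} (hle : ν ≤ c • μ)
    (h : ∀ (Λ₀ : Finset V) (ε : ℝ≥0), 0 < ε → ∃ Λ₁ : Finset V, ∀ A B : Set (V → F),
      DependsOn (· ∈ A) (Λ₀ : Set V) → DependsOn (· ∈ B) (Λ₁ : Set V)ᶜ →
      (∃ S : Finset V, DependsOn (· ∈ B) (S : Set V)) → μ (A ∩ B) ≤ μ A * μ B + ε) :
    ν = μ := by
  classical
  obtain ⟨hμp, hμ⟩ := hμ
  obtain ⟨hνp, hν⟩ := hν
  have key : ∀ (S : Finset V) (A : Set (V → F)), DependsOn (· ∈ A) (S : Set V) → ν A ≤ μ A := by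
    intro S A hA
    have hAm := hA.measurableSet
    have hε : ∀ ε : ℝ≥0, 0 < ε → ν A ≤ μ A + c * ε := by
      intro ε hε
      obtain ⟨Λ₁, hΛ₁⟩ := h S ε hε
      set g : (V → F) → ℝ≥0∞ := fun ω => M.gibbs Λ₁ ω A with hg
      have hgm : Measurable g := M.measurable_gibbs_apply Λ₁ hAm
      -- Asymptotic independence is tested on the far away event that the boundary condition of
      -- `Λ₁` favours `A`.
      set B : Set (V → F) := {ω | μ A < g ω} with hB
      have hBd : DependsOn (· ∈ B) ((M.vicinity Λ₁ ∪ S : Set V) \ Λ₁) := by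
        intro x y hxy
        have : g x = g y := M.dependsOn_gibbs Λ₁ hA hAm hxy
        simp only [hB, Set.mem_ofPred_eq, this]
      have hBout : DependsOn (· ∈ B) (Λ₁ : Set V)ᶜ := hBd.mono fun i hi => hi.2
      have hBloc : DependsOn (· ∈ B) ((M.vicinity Λ₁ ∪ S : Finset V) : Set V) := by
        rw [Finset.coe_union]
        exact hBd.mono Set.sdiff_subset
      have hBm := hBloc.measurableSet
      have hint : ∫⁻ x, (g x - μ A) ∂μ + μ A * μ B = μ (A ∩ B) := by
        have e1 : ∀ x, g x - μ A = B.indicator (fun x => g x - μ A) x := by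
          intro x
          rw [Set.indicator_apply]
          split_ifs with hx
          · rfl
          · exact tsub_eq_zero_of_le (not_lt.1 hx)
        rw [(hμ Λ₁).2 _ (hAm.inter hBm), ← lintegral_indicator_const hBm, lintegral_congr e1,
          ← lintegral_add_left ((hgm.sub_const _).indicator hBm)]
        refine lintegral_congr fun x => ?_
        rw [M.gibbs_inter_of_dependsOn_compl Λ₁ x hBout hAm hBm]
        simp only [Set.indicator_apply]
        split_ifs with hx
        · exact tsub_add_cancel_of_le (le_of_lt hx)
        · simp
      have hsmall : ∫⁻ x, (g x - μ A) ∂μ ≤ ε := by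
        have := hΛ₁ A B hA hBout ⟨_, hBloc⟩
        rw [← hint, add_comm] at this
        exact (ENNReal.add_le_add_iff_left (by finiteness)).1 this
      calc ν A = ∫⁻ x, g x ∂ν := (hν Λ₁).2 A hAm
        _ ≤ ∫⁻ x, (μ A + (g x - μ A)) ∂ν := lintegral_mono fun x => le_add_tsub
        _ = μ A + ∫⁻ x, (g x - μ A) ∂ν := by
            rw [lintegral_add_left measurable_const, lintegral_const, measure_univ, mul_one]
        _ ≤ μ A + ∫⁻ x, (g x - μ A) ∂(c • μ) := by gcongr
        _ = μ A + c * ∫⁻ x, (g x - μ A) ∂μ := by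
            rw [lintegral_smul_measure]; rfl
        _ ≤ μ A + c * ε := by gcongr
    have hlim : Tendsto (fun ε : ℝ≥0 => μ A + c * (ε : ℝ≥0∞)) (𝓝[>] 0) (𝓝 (μ A)) := by
      have : Tendsto (fun ε : ℝ≥0 => μ A + ((c * ε : ℝ≥0) : ℝ≥0∞)) (𝓝 0)
          (𝓝 (μ A + ((c * 0 : ℝ≥0) : ℝ≥0∞))) :=
        tendsto_const_nhds.add (ENNReal.tendsto_coe.2 (tendsto_const_nhds.mul tendsto_id))
      simpa using this.mono_left nhdsWithin_le_nhds
    exact ge_of_tendsto hlim (eventually_mem_nhdsWithin.mono hε)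
  refine Measure.ext_of_dependsOn fun S A hAm hA => le_antisymm (key S A hA) ?_
  have hAc : DependsOn (· ∈ Aᶜ) (S : Set V) := fun x y hxy => congrArg Not (hA hxy)
  have := key S Aᶜ hAc
  rw [prob_compl_eq_one_sub hAm, prob_compl_eq_one_sub hAm] at this
  exact (ENNReal.sub_le_sub_iff_left prob_le_one ENNReal.one_ne_top).1 this

theorem mem_extremePoints_gibbsStates {μ : Measure (V → F)} (hμ : μ ∈ M.gibbsStates)
    (h : ∀ (Λ₀ : Finset V) (ε : ℝ≥0), 0 < ε → ∃ Λ₁ : Finset V, ∀ A B : Set (V → F),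
      DependsOn (· ∈ A) (Λ₀ : Set V) → DependsOn (· ∈ B) (Λ₁ : Set V)ᶜ →
      (∃ S : Finset V, DependsOn (· ∈ B) (S : Set V)) → μ (A ∩ B) ≤ μ A * μ B + ε) :
    μ ∈ Set.extremePoints ℝ≥0 M.gibbsStates := by
  refine mem_extremePoints.2 ⟨hμ, ?_⟩
  rintro ν₁ hν₁ ν₂ hν₂ ⟨a, b, ha, hb, -, hab⟩
  have hdom : ∀ {a : ℝ≥0} {ν : Measure (V → F)}, 0 < a → a • ν ≤ μ → ν ≤ a⁻¹ • μ := by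
    intro a ν ha hle
    calc ν = a⁻¹ • a • ν := by rw [smul_smul, inv_mul_cancel₀ ha.ne', one_smul]
      _ ≤ a⁻¹ • μ := by gcongr
  exact ⟨eq_of_le_smul_of_inter_le hμ hν₁ (hdom ha (hab ▸ Measure.le_add_right le_rfl)) h,
    eq_of_le_smul_of_inter_le hμ hν₂ (hdom hb (hab ▸ Measure.le_add_left le_rfl)) h⟩

end

end SpinModel

theorem corollary2p81 {V F G : Type*} [Countable V] [Fintype F] [TopologicalSpace F]
    [DiscreteTopology F] [MeasurableSpace F] [BorelSpace F] [AddCommGroup G] (val : F ↪ G)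
    (M : SpinModel V F)
    (Λ : ℕ → Finset V) (hΛ : Tendsto Λ atTop atTop)
    (ω : ℕ → V → F) (hω : ∀ n, M.partition (Λ n) (ω n) ≠ 0)
    (μ : ProbabilityMeasure (V → F))
    (hμ : Tendsto (fun n => M.gibbsProb (Λ n) (ω n) (hω n)) atTop (𝓝 μ))
    (ν : (n : ℕ) → (σ : Λ n → G) → PMF (M.HyperbondConfig val (Λ n) (ω n) σ))
    (hν : ∀ n, ∀ σ : Λ n → G, M.overlapMass val (Λ n) (ω n) σ ≠ 0 →
      M.IsRCR val (ν n σ) ∧ M.IsSymmetricBase val (ν n σ))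
    (hconn : ∀ Λ₀ : Finset V, ∀ ε : ℝ, 0 < ε → ∃ Λ₁ Λ₂ : Finset V, Λ₀ ⊆ Λ₁ ∧
      ∀ n, Λ₂ ⊆ Λ n →
        (M.integratedConnProb val (ν n) Λ₀ (M.boundary Λ₁) ≤ ENNReal.ofReal ε ∨
          1 - ENNReal.ofReal ε ≤ M.overlapProb val (Λ n) (ω n)
            {σ | M.connProb val (ν n σ) Λ₀ (M.boundary Λ₁) ≤ ENNReal.ofReal ε})) :
    (μ : Measure (V → F)) ∈ Set.extremePoints ℝ≥0 M.gibbsStates := by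
  refine SpinModel.mem_extremePoints_gibbsStates
    (SpinModel.mem_gibbsStates_of_tendsto hΛ hω hμ) fun Λ₀ ε hε => ?_
  -- The alternative (b) costs twice its parameter, whence `ε / 2`.
  obtain ⟨Λ₁, Λ₂, h01, hconn⟩ := hconn Λ₀ (ε / 2 : ℝ≥0) (by positivity)
  rw [ENNReal.ofReal_coe_nnreal] at hconn
  have hhalf : ((ε / 2 : ℝ≥0) : ℝ≥0∞) + (ε / 2 : ℝ≥0) = ε := by
    rw [← ENNReal.coe_add, add_halves]
  refine ⟨Λ₁, fun A B hA hBout ⟨S, hB⟩ => ?_⟩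
  have hAB : DependsOn (· ∈ A ∩ B) ((Λ₀ : Set V) ∪ S) := by
    intro x y hxy
    have h1 : (x ∈ A) = (y ∈ A) := hA fun i hi => hxy i (Or.inl hi)
    have h2 : (x ∈ B) = (y ∈ B) := hB fun i hi => hxy i (Or.inr hi)
    simp only [Set.mem_inter_iff, h1, h2]
  classical
  rw [← Finset.coe_union] at hAB
  refine le_of_tendsto_of_tendsto (hAB.tendsto_measure hμ)
    ((ENNReal.Tendsto.mul (hA.tendsto_measure hμ) (Or.inr (by finiteness))
      (hB.tendsto_measure hμ) (Or.inr (by finiteness))).add tendsto_const_nhds) ?_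
  filter_upwards [hΛ.eventually_ge_atTop Λ₁, hΛ.eventually_ge_atTop Λ₂] with n h1 h2
  refine (SpinModel.gibbs_inter_le (hω n) (hν n) h01 h1 hA hBout hA.measurableSet
    hB.measurableSet).trans ?_
  gcongr
  · exact le_rfl
  · exact le_rfl
  · rcases hconn n h2 with h | h
    · exact (h.trans le_self_add).trans_eq hhalf
    · exact (SpinModel.integratedConnProb_le (hω n) (fun σ hσ => (hν n σ hσ).1) h).trans_eq hhalf
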